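/- Let $f\in\mathbb Z[X]$ be a separable polynomial of degree $n>1$ (not necessarily monic), and let $p$ be a prime that does not divide the leading coefficient $\ell_f$ of $f$ and is such that $f \bmod p$ is separable in $\mathbb F_p[X]$. Let $f=\ell_f f_1\cdots f_r$ with $f_1,\dots,f_r\in\mathbb Z_p[X]$ monic and irreducible (the local factors), and let $g_1,\dots,g_s$ be the monic irreducible factors of $f$ in $\mathbb Q[X]$. Write $g_j=f_1^{w_{j,1}}\cdots f_r^{w_{j,r}}$, put $w_j=(w_{j,1},\dots,w_{j,r})\in\mathbb Z^r$ and $W=\mathbb Zw_1+\dots+\mathbb Zw_s$. Let $\|\cdot\|$ denote the Euclidean norm of vectors and of coefficient vectors of polynomials, and let $$B=2^{n-1}\,n\,\|f\|,\qquad B'=\sqrt{r^2+B^2}.$$ For a divisor $g$ of $f$ let $\Phi(g)=f g'/g$. Let $\ell\ge 1$, and let $A_1=(a_{i,j})_{0\le i<n,\,1\le j\le r}$ be any integer matrix such that $\sum_{i=0}^{n-1}a_{i,j}X^i\equiv\Phi(f_j) \pmod{p^\ell}$ for $1\le j\le r$. Let the all-coefficients lattice $L\subset\mathbb Z^{r+n}$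 be the span of the columns of $$\begin{pmatrix} I_r & 0\\ A_1 & p^\ell I_n\end{pmatrix}.$$ Let $b_1,\dots,b_{r+n}$ be a basis of $L$ that is LLL-reduced with the original parameter $3/4$: if $b_1^*,\dots,b_{r+n}^*$ is its Gram–Schmidt orthogonalization (without normalization) and $\mu_{i,j}=\langle b_i,b_j^*\rangle/\langle b_j^*,b_j^*\rangle$, then $|\mu_{i,j}|\le\frac12$ for $j<i$, and $\|b_{i+1}^*+\mu_{i+1,i}b_i^*\|^2\ge\frac34\|b_i^*\|^2$ for $1\le i<r+n$. Let $t\ge 0$ be the smallest integer such that $\|b_j^*\|>B'$ for all $j>t$, and let $L'=\mathbb Zb_1+\dots+\mathbb Zb_t$. If $$p^{\ell/n}>\|f\|\,(2^{n-1}+n)\,B'(1+B'),$$ then the projection of $L'$ onto the first $r$ coordinates is equal to $W$. -/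

import Mathlib

open Polynomial

namespace AllCoefficients

/-- The `L²` norm of the coefficient vector of an integer polynomial. -/
noncomputable def polyNorm (f : ℤ[X]) : ℝ :=
  Real.sqrt (∑ i ∈ f.support, (f.coeff i : ℝ) ^ 2)

/-- `B(f) = 2 ^ (n - 1) * n * ‖f‖` with `n = deg f`. -/
noncomputable def boundB (f : ℤ[X]) : ℝ :=
  2 ^ (f.natDegree - 1) * (f.natDegree : ℝ) * polyNorm f

/-- `B' = √(r² + B(f)²)`. -/
noncomputable def boundB' (f : ℤ[X]) (r : ℕ) : ℝ :=
  Real.sqrt ((r : ℝ) ^ 2 + boundB f ^ 2)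

/-- `Φ(g) = f g' / g` for a monic divisor `g` of `f`; the division is then exact
(see `Phi_mul_self`). -/
noncomputable def Phi {R : Type*} [CommRing R] (f g : R[X]) : R[X] :=
  (f * derivative g) /ₘ g

theorem Phi_mul_self {R : Type*} [CommRing R] {f g : R[X]} (hg : g.Monic) (h : g ∣ f) :
    Phi f g * g = f * derivative g := by
  obtain ⟨q, rfl⟩ := h
  rw [Phi, mul_assoc, mul_divByMonic_cancel_left _ hg]
  ring

/-- `F₁, …, F_r` are the local factors of `f` at `p`: monic irreducible polynomials over the
`p`-adic integers with `f = lc(f) F₁ ⋯ F_r`. -/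
structure IsLocalFactorization (p : ℕ) [Fact p.Prime] (f : ℤ[X]) {r : ℕ}
    (F : Fin r → ℤ_[p][X]) : Prop where
  monic : ∀ j, (F j).Monic
  irreducible : ∀ j, Irreducible (F j)
  prod_eq : f.map (Int.castRingHom ℤ_[p]) = C (f.leadingCoeff : ℤ_[p]) * ∏ j, F j

/-- `e` is the exponent vector, with respect to the local factors `F`, of a monic irreducible
factor `g` of `f` in `ℚ[X]`, that is `g = ∏ Fᵢ ^ eᵢ` in `ℚ_p[X]`. -/
def IsRationalFactorVector (p : ℕ) [Fact p.Prime] (f : ℤ[X]) {r : ℕ}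
    (F : Fin r → ℤ_[p][X]) (e : Fin r → ℕ) : Prop :=
  ∃ g : ℚ[X], g.Monic ∧ Irreducible g ∧ g ∣ f.map (Int.castRingHom ℚ) ∧
    g.map (algebraMap ℚ ℚ_[p]) = ∏ i, ((F i).map (algebraMap ℤ_[p] ℚ_[p])) ^ e i

/-- The lattice `W ⊆ ℤ^r` spanned by the exponent vectors of the rational factors of `f`. -/
def factorLattice (p : ℕ) [Fact p.Prime] (f : ℤ[X]) {r : ℕ}
    (F : Fin r → ℤ_[p][X]) : Submodule ℤ (Fin r → ℤ) :=
  Submodule.span ℤ {w | ∃ e, IsRationalFactorVector p f F e ∧ w = fun i => (e i : ℤ)}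

/-- `A` is a matrix of integers whose `j`-th column lists the coefficients of `X⁰, …, X^(n-1)`
in a lift to `ℤ[X]` of `Φ(F_j)` modulo `p ^ l`. -/
def IsCoeffMatrix (p : ℕ) [Fact p.Prime] (l : ℕ) (f : ℤ[X]) {r n : ℕ}
    (F : Fin r → ℤ_[p][X]) (A : Matrix (Fin n) (Fin r) ℤ) : Prop :=
  ∀ i j, (p : ℤ_[p]) ^ l ∣
    (A i j : ℤ_[p]) - (Phi (f.map (Int.castRingHom ℤ_[p])) (F j)).coeff (i : ℕ)

/-- The all-coefficients lattice in `ℤ^(r+n)`: the span of the columns of the block matrix with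
rows `(I_r, 0)` and `(A, p ^ l I_n)`. -/
def allCoeffLattice (p l : ℕ) {r n : ℕ} (A : Matrix (Fin n) (Fin r) ℤ) :
    Submodule ℤ (Fin r ⊕ Fin n → ℤ) :=
  Submodule.span ℤ (Set.range 
    (Matrix.fromBlocks (1 : Matrix (Fin r) (Fin r) ℤ) (0 : Matrix (Fin r) (Fin n) ℤ)
      A ((p : ℤ) ^ l • (1 : Matrix (Fin n) (Fin n) ℤ))).col)

/-- An integer vector, seen in Euclidean space. -/
noncomputable def toEuclid {ι : Type*} (v : ι → ℤ) : EuclideanSpace ℝ ι :=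
  WithLp.toLp 2 fun i => (v i : ℝ)

/-- The Gram-Schmidt orthogonalization `b*₁, …, b*_m` (not normalized). -/
noncomputable def gs {ι : Type*} [Fintype ι] {m : ℕ} (b : Fin m → ι → ℤ) (i : Fin m) :
    EuclideanSpace ℝ ι :=
  InnerProductSpace.gramSchmidt ℝ (fun k => toEuclid (b k)) i

/-- The Gram-Schmidt coefficient `μ_{i,j} = ⟨b_i, b*_j⟩ / ⟨b*_j, b*_j⟩`. -/
noncomputable def gsCoeff {ι : Type*} [Fintype ι] {m : ℕ} (b : Fin m → ι → ℤ)
    (i j : Fin m) : ℝ :=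
  inner ℝ (toEuclid (b i)) (gs b j) / ‖gs b j‖ ^ 2

/-- The family `b` (a basis of the lattice that it spans) is LLL-reduced, with the original
parameter `3/4`. -/
structure IsLLLReduced {ι : Type*} [Fintype ι] {m : ℕ} (b : Fin m → ι → ℤ) : Prop where
  linearIndependent : LinearIndependent ℤ b
  size_reduced : ∀ i j : Fin m, j < i → |gsCoeff b i j| ≤ 1 / 2
  lovasz : ∀ i j : Fin m, (i : ℕ) + 1 = j →
    3 / 4 * ‖gs b i‖ ^ 2 ≤ ‖gs b j + gsCoeff b j i • gs b i‖ ^ 2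

/-- `t` is the smallest number such that `‖b*_j‖ > B` for all `j > t`, where `b₁, b₂, …` are
numbered from `1` (so that `b_j` is `b` at the index `j - 1` here). -/
def IsCutoff {ι : Type*} [Fintype ι] {m : ℕ} (b : Fin m → ι → ℤ) (B : ℝ) (t : ℕ) : Prop :=
  IsLeast {t : ℕ | ∀ k : Fin m, t ≤ (k : ℕ) → B < ‖gs b k‖} t

/-- The sublattice spanned by the first `t` vectors `b₁, …, b_t`. -/
def headLattice {ι : Type*} {m : ℕ} (b : Fin m → ι → ℤ) (t : ℕ) : Submodule ℤ (ι → ℤ) :=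
  Submodule.span ℤ (b '' {k | (k : ℕ) < t})

end AllCoefficients

namespace AllCoefficients

/-! ### Gram–Schmidt data of LLL-reduced bases and the cutoff. -/

section Lattice

variable {ι : Type*} [Fintype ι] {m : ℕ} {b : Fin m → ι → ℤ}

/-! The logarithmic derivative turns products into sums: if g = ∏ F_j ^ e_j then f g'/g = ∑ e_j
Φ(F_j). So each exponent vector e extends, by the coefficients of the integer polynomial f g'/g, to
a vector of L. A Mahler measure estimate shows that its norm is at most B'
(`IsCoeffMatrix.exists_short_vector`), and lattice vectors this short lie in L'
(`IsCutoff.mem_headLattice`). Hence W is contained in the projection.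

Conversely, LLL reduction gives ‖b_k‖² ≤ 2^(t-1) B'² for the first t basis vectors, where t ≤ r + n
≤ 2n. Let v be one of them, with tail polynomial h, let g be a rational factor, and let F_i divide
g. Since f' = ∑ Φ(F_j) and F_i divides Φ(F_j) for j ≠ i, the polynomial u = h - v_i f' is a multiple
of F_i modulo p^l. So p^l divides Res(G, u), with G an integral multiple of g
(`IsCoeffMatrix.pow_dvd_resultant`). The hypothesis on p^l makes this resultant smaller than p^l, so
it vanishes and g divides u (`IsCoeffMatrix.dvd_of_short`). If F_k also divides g, subtraction gives
g ∣ (v_i - v_k) f', and separability of f forces v_i = v_k. Thus v is constant on the support of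
each exponent vector; these supports partition the local factors, so the projection of v lies in W
(`mem_factorLattice_of_const`). -/

theorem inner_gs_gs_of_ne {i j : Fin m} (h : i ≠ j) : inner ℝ (gs b i) (gs b j) = 0 :=
  InnerProductSpace.gramSchmidt_orthogonal ℝ _ h

theorem inner_gs_toEuclid_of_lt {i j : Fin m} (h : i < j) :
    inner ℝ (gs b j) (toEuclid (b i)) = 0 :=
  InnerProductSpace.gramSchmidt_inv_triangular (𝕜 := ℝ) (fun k => toEuclid (b k)) h

theorem toEuclid_eq_gs_add_sum (i : Fin m) :
    toEuclid (b i) = gs b i + ∑ j ∈ Finset.Iio i, gsCoeff b i j • gs b j := by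
  have h := InnerProductSpace.gramSchmidt_def'' ℝ (fun k => toEuclid (b k)) i
  simp only [gsCoeff]
  refine h.trans ?_
  congr 1
  refine Finset.sum_congr rfl fun j _ => ?_
  rw [real_inner_comm]
  rfl

theorem inner_gs_toEuclid_self (i : Fin m) :
    inner ℝ (gs b i) (toEuclid (b i)) = ‖gs b i‖ ^ 2 := by
  rw [toEuclid_eq_gs_add_sum, inner_add_right, real_inner_self_eq_norm_sq, inner_sum,
    Finset.sum_eq_zero, add_zero]
  intro j hj
  rw [inner_smul_right, inner_gs_gs_of_ne (Finset.mem_Iio.1 hj).ne', mul_zero]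

theorem norm_toEuclid_sq_eq (i : Fin m) :
    ‖toEuclid (b i)‖ ^ 2 =
      ‖gs b i‖ ^ 2 + ∑ j ∈ Finset.Iio i, gsCoeff b i j ^ 2 * ‖gs b j‖ ^ 2 := by
  rw [← real_inner_self_eq_norm_sq]
  nth_rw 1 [toEuclid_eq_gs_add_sum i]
  rw [inner_add_left, inner_gs_toEuclid_self, sum_inner]
  congr 1
  refine Finset.sum_congr rfl fun j hj => ?_
  rw [inner_smul_left, toEuclid_eq_gs_add_sum i, inner_add_right,
    inner_gs_gs_of_ne (Finset.mem_Iio.1 hj).ne, inner_sum, Finset.sum_eq_single j]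
  · rw [inner_smul_right, real_inner_self_eq_norm_sq]
    simp only [conj_trivial]
    ring
  · intro k _ hk
    rw [inner_smul_right, inner_gs_gs_of_ne hk.symm, mul_zero]
  · exact fun h => absurd hj h

theorem IsLLLReduced.gsCoeff_sq_le (hb : IsLLLReduced b) {i j : Fin m} (h : j < i) :
    gsCoeff b i j ^ 2 ≤ 1 / 4 := by
  have := sq_le_sq' (abs_le.1 (hb.size_reduced i j h)).1 (abs_le.1 (hb.size_reduced i j h)).2
  linarith

/-- By orthogonality the Lovász condition reads ‖b*_j‖² ≥ (3/4 - μ²)‖b*_i‖², and μ² ≤ 1/4. -/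
theorem IsLLLReduced.norm_gs_sq_le_two_mul (hb : IsLLLReduced b) {i j : Fin m}
    (h : (i : ℕ) + 1 = j) : ‖gs b i‖ ^ 2 ≤ 2 * ‖gs b j‖ ^ 2 := by
  have hij : i < j := Fin.lt_def.2 (by omega)
  have h1 := hb.lovasz i j h
  rw [norm_add_sq_real, inner_smul_right, inner_gs_gs_of_ne hij.ne', norm_smul, mul_pow,
    Real.norm_eq_abs, sq_abs] at h1
  have h2 := mul_le_mul_of_nonneg_right (hb.gsCoeff_sq_le hij) (sq_nonneg ‖gs b i‖)
  linarith

theorem IsLLLReduced.norm_gs_sq_le_pow_mul (hb : IsLLLReduced b) (d : ℕ) :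
    ∀ {i j : Fin m}, (i : ℕ) + d = j → ‖gs b i‖ ^ 2 ≤ 2 ^ d * ‖gs b j‖ ^ 2 := by
  induction d with
  | zero =>
    intro i j h
    obtain rfl : i = j := Fin.ext (by simpa using h)
    simp
  | succ d ih =>
    intro i j h
    have hd : (i : ℕ) + d < m := by have := j.2; omega
    have h1 := ih (i := i) (j := ⟨i + d, hd⟩) rfl
    have h2 := hb.norm_gs_sq_le_two_mul (i := ⟨i + d, hd⟩) (j := j) (by simpa [add_assoc] using h)
    calc _ ≤ _ := h1
      _ ≤ 2 ^ d * (2 * ‖gs b j‖ ^ 2) := by gcongr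
      _ = _ := by ring

theorem IsLLLReduced.norm_toEuclid_sq_le (hb : IsLLLReduced b) (i : Fin m) :
    ‖toEuclid (b i)‖ ^ 2 ≤ 2 ^ (i : ℕ) * ‖gs b i‖ ^ 2 := by
  have hsum : ∑ j ∈ Finset.Iio i, (2 : ℝ) ^ ((i : ℕ) - j) = 2 ^ ((i : ℕ) + 1) - 2 := by
    have h1 : ∑ j ∈ Finset.Iio i, (2 : ℝ) ^ ((i : ℕ) - j) =
        ∑ j ∈ Finset.range i, (2 : ℝ) ^ ((i : ℕ) - j) := by
      rw [← Nat.Iio_eq_range, ← Fin.map_valEmbedding_Iio, Finset.sum_map]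
      rfl
    rw [h1]
    have h2 : ∀ k : ℕ, ∑ j ∈ Finset.range k, (2 : ℝ) ^ (k - j) = 2 ^ (k + 1) - 2 := by
      intro k
      induction k with
      | zero => norm_num
      | succ k ih =>
        rw [Finset.sum_range_succ']
        simp only [Nat.add_sub_add_right, ih, Nat.sub_zero]
        ring
    exact h2 _
  have hle : ∑ j ∈ Finset.Iio i, gsCoeff b i j ^ 2 * ‖gs b j‖ ^ 2 ≤
      ∑ j ∈ Finset.Iio i, 1 / 4 * ((2 : ℝ) ^ ((i : ℕ) - j) * ‖gs b i‖ ^ 2) := by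
    refine Finset.sum_le_sum fun j hj => ?_
    have hji := Finset.mem_Iio.1 hj
    exact mul_le_mul (hb.gsCoeff_sq_le hji)
      (hb.norm_gs_sq_le_pow_mul _ (by have := Fin.lt_def.1 hji; omega)) (by positivity)
      (by norm_num)
  rw [← Finset.mul_sum, ← Finset.sum_mul, hsum] at hle
  rw [norm_toEuclid_sq_eq]
  -- The total factor is 1 + (2^(i+1) - 2)/4 = (2^i + 1)/2, which is at most 2^i.
  have h1 : (1 : ℝ) ≤ 2 ^ (i : ℕ) := one_le_pow₀ (by norm_num)
  rw [pow_succ] at hle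
  nlinarith [sq_nonneg ‖gs b i‖]

theorem IsCutoff.le {B : ℝ} {t : ℕ} (ht : IsCutoff b B t) : t ≤ m :=
  ht.2 fun k hk => absurd k.2 (not_lt.2 hk)

/-- Otherwise t - 1 would also be an admissible cutoff, against minimality. -/
theorem IsCutoff.norm_gs_le {B : ℝ} {t : ℕ} (ht : IsCutoff b B t) {k : Fin m}
    (hk : (k : ℕ) + 1 = t) : ‖gs b k‖ ≤ B := by
  by_contra! h
  have : t ≤ (k : ℕ) := ht.2 fun j hj => by
    rcases hj.eq_or_lt with hj | hj
    · rwa [← Fin.ext hj]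
    · exact ht.1 j (by omega)
  omega

theorem IsLLLReduced.norm_toEuclid_sq_le_of_lt_cutoff (hb : IsLLLReduced b) {B : ℝ} {t : ℕ}
    (ht : IsCutoff b B t) {i : Fin m} (hi : (i : ℕ) < t) :
    ‖toEuclid (b i)‖ ^ 2 ≤ 2 ^ (t - 1) * B ^ 2 := by
  have htm := ht.le
  have h1 := ht.norm_gs_le (k := ⟨t - 1, by omega⟩) (by simp; omega)
  have h2 := hb.norm_gs_sq_le_pow_mul (t - 1 - i) (i := i) (j := ⟨t - 1, by omega⟩)
    (by simp; omega)
  calc _ ≤ _ := hb.norm_toEuclid_sq_le i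
    _ ≤ 2 ^ (i : ℕ) * (2 ^ (t - 1 - i) * B ^ 2) := by
      refine mul_le_mul_of_nonneg_left (h2.trans ?_) (by positivity)
      gcongr
    _ = _ := by rw [← mul_assoc, ← pow_add]; congr 2; omega

/-- If k is the last index with nonzero coefficient c and k is beyond the cutoff, then ⟨b*_k, v⟩ = c
‖b*_k‖² with |c| ≥ 1, so Cauchy–Schwarz gives ‖v‖ ≥ ‖b*_k‖ > B. -/
theorem IsCutoff.mem_headLattice {B : ℝ} (hB : 0 ≤ B) {t : ℕ} (ht : IsCutoff b B t) {v : ι → ℤ}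
    (hv : v ∈ Submodule.span ℤ (Set.range b)) (hvB : ‖toEuclid v‖ ≤ B) :
    v ∈ headLattice b t := by
  classical
  obtain ⟨c, rfl⟩ := (Submodule.mem_span_range_iff_exists_fun ℤ).1 hv
  have hE : toEuclid (∑ k, c k • b k) = ∑ k, (c k : ℝ) • toEuclid (b k) := by
    ext x
    simp [toEuclid]
  suffices h0 : ∀ k : Fin m, t ≤ (k : ℕ) → c k = 0 by
    refine Submodule.sum_mem _ fun k _ => ?_
    by_cases hk : (k : ℕ) < t
    · exact Submodule.smul_mem _ _ (Submodule.subset_span ⟨k, hk, rfl⟩)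
    · rw [h0 k (not_lt.1 hk), zero_smul]
      exact Submodule.zero_mem _
  by_contra! hne
  obtain ⟨k₀, hk₀⟩ := hne
  obtain ⟨k, hk, hmax⟩ := (Finset.univ.filter fun k : Fin m => t ≤ (k : ℕ) ∧ c k ≠ 0).exists_max_image
    id ⟨k₀, by simpa using hk₀⟩
  simp only [Finset.mem_filter, Finset.mem_univ, true_and, id] at hk hmax
  have hin : inner ℝ (gs b k) (toEuclid (∑ k, c k • b k)) = c k * ‖gs b k‖ ^ 2 := by
    rw [hE, inner_sum, Finset.sum_eq_single k]
    · rw [inner_smul_right, inner_gs_toEuclid_self]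
    · intro j _ hj
      rw [inner_smul_right]
      rcases lt_or_gt_of_ne hj with h | h
      · rw [inner_gs_toEuclid_of_lt h, mul_zero]
      · by_cases hcj : c j = 0
        · simp [hcj]
        · exact absurd (hmax j ⟨hk.1.trans (Fin.lt_def.1 h).le, hcj⟩) (not_le.2 h)
    · simp
  have hgs := ht.1 k hk.1
  have hc : (1 : ℝ) ≤ |(c k : ℝ)| := by
    rw [← Int.cast_abs]
    exact_mod_cast Int.one_le_abs hk.2
  have hCS := abs_real_inner_le_norm (gs b k) (toEuclid (∑ k, c k • b k))
  rw [hin, abs_mul, abs_of_nonneg (sq_nonneg ‖gs b k‖)] at hCS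
  have hpos : 0 < ‖gs b k‖ := hB.trans_lt hgs
  have h3 : ‖gs b k‖ * ‖gs b k‖ ≤ ‖gs b k‖ * B := by
    nlinarith [mul_le_mul_of_nonneg_right hc (sq_nonneg ‖gs b k‖),
      mul_le_mul_of_nonneg_left hvB hpos.le]
  exact absurd (le_of_mul_le_mul_left h3 hpos) (not_le.2 hgs)

theorem norm_toEuclid_sq (v : ι → ℤ) : ‖toEuclid v‖ ^ 2 = ∑ i, (v i : ℝ) ^ 2 := by
  simp [toEuclid, EuclideanSpace.norm_sq_eq]

end Lattice

/-! ### Mahler measure bounds for coefficients and resultants. -/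

section Bounds

theorem sum_norm_coeff_le (q : ℂ[X]) {N : ℕ} (hq : q.natDegree ≤ N) :
    ∑ i ∈ Finset.range (N + 1), ‖q.coeff i‖ ≤ 2 ^ N * q.mahlerMeasure := by
  calc ∑ i ∈ Finset.range (N + 1), ‖q.coeff i‖
      ≤ ∑ i ∈ Finset.range (N + 1), (N.choose i : ℝ) * q.mahlerMeasure := by
        refine Finset.sum_le_sum fun i _ => (norm_coeff_le_choose_mul_mahlerMeasure i q).trans ?_
        have : (q.natDegree.choose i : ℝ) ≤ N.choose i := by
          exact_mod_cast Nat.choose_le_choose i hq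
        exact mul_le_mul_of_nonneg_right this q.mahlerMeasure_nonneg
    _ = 2 ^ N * q.mahlerMeasure := by
        rw [← Finset.sum_mul]
        congr 1
        exact_mod_cast Nat.sum_range_choose N

theorem mahlerMeasure_le_of_X_sub_C_mul_eq {f q : ℂ[X]} {a : ℂ} (h : (X - C a) * q = f) :
    q.mahlerMeasure ≤ f.mahlerMeasure := by
  rw [← h, mahlerMeasure_mul, mahlerMeasure_X_sub_C]
  exact le_mul_of_one_le_left q.mahlerMeasure_nonneg (le_max_left _ _)

/-- By the product rule, k times the derivative is the sum over a in s of f/(X - a). Each quotient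
has degree at most N and Mahler measure at most that of f. The induction moves the factor X - a into
k. -/
theorem sum_norm_coeff_mul_derivative_prod_le {f : ℂ[X]} (hf : f ≠ 0) {N : ℕ}
    (hN : f.natDegree ≤ N + 1) (s : Multiset ℂ) :
    ∀ k : ℂ[X], (s.map fun a => X - C a).prod * k = f →
      ∑ i ∈ Finset.range (N + 1), ‖(k * derivative (s.map fun a => X - C a).prod).coeff i‖ ≤
        Multiset.card s * (2 ^ N * f.mahlerMeasure) := by
  induction s using Multiset.induction_on with
  | empty => intro k _; simp
  | cons a s ih =>
    intro k hk
    set g := (s.map fun a => X - C a).prod with hg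
    rw [Multiset.map_cons, Multiset.prod_cons, ← hg] at hk ⊢
    have h1 : (X - C a) * (g * k) = f := by rw [← hk]; ring
    have hgk : g * k ≠ 0 := by rintro h; rw [h, mul_zero] at h1; exact hf h1.symm
    have hdeg : (g * k).natDegree ≤ N := by
      have := congrArg natDegree h1
      rw [natDegree_mul (X_sub_C_ne_zero a) hgk, natDegree_X_sub_C] at this
      omega
    have h2 := (sum_norm_coeff_le _ hdeg).trans
      (mul_le_mul_of_nonneg_left (mahlerMeasure_le_of_X_sub_C_mul_eq h1) (by positivity))
    have h3 := ih (k * (X - C a)) (by rw [← hk]; ring)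
    have h4 : k * derivative ((X - C a) * g) = g * k + k * (X - C a) * derivative g := by
      simp only [derivative_mul, derivative_sub, derivative_X, derivative_C]
      ring
    rw [h4]
    calc _ ≤ ∑ i ∈ Finset.range (N + 1),
          (‖(g * k).coeff i‖ + ‖(k * (X - C a) * derivative g).coeff i‖) :=
          Finset.sum_le_sum fun i _ => by rw [coeff_add]; exact norm_add_le _ _
      _ ≤ _ := by
        rw [Finset.sum_add_distrib, Multiset.card_cons]
        push_cast
        linarith

theorem mahlerMeasure_map_le_polyNorm (f : ℤ[X]) :
    (f.map (Int.castRingHom ℂ)).mahlerMeasure ≤ polyNorm f := by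
  refine (mahlerMeasure_le_sqrt_sum_sq_norm_coeff _).trans_eq ?_
  rw [polyNorm, support_map_of_injective _ (RingHom.injective_int _)]
  simp

theorem polyNorm_nonneg (f : ℤ[X]) : 0 ≤ polyNorm f := Real.sqrt_nonneg _

theorem one_le_polyNorm {f : ℤ[X]} (hf : f ≠ 0) : 1 ≤ polyNorm f :=
  (one_le_mahlerMeasure_of_ne_zero hf).trans (mahlerMeasure_map_le_polyNorm f)

/-- The coefficient bound for `f G' / G`, where `q = f / G`. -/
theorem sum_abs_coeff_mul_derivative_le {f G q : ℤ[X]} (hf : f ≠ 0) (h : f = G * q) :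
    ∑ i ∈ Finset.range f.natDegree, |((q * derivative G).coeff i : ℝ)| ≤
      f.natDegree * (2 ^ (f.natDegree - 1) * polyNorm f) := by
  rcases Nat.eq_zero_or_pos f.natDegree with h0 | hpos
  · simp [h0]
  obtain ⟨N, hN⟩ : ∃ N, f.natDegree = N + 1 := ⟨f.natDegree - 1, by omega⟩
  set φ := Int.castRingHom ℂ with hφ
  have hinj : Function.Injective φ := RingHom.injective_int _
  obtain ⟨c, s, hGs⟩ : ∃ (c : ℂ) (s : Multiset ℂ),
      G.map φ = C c * (s.map fun a => X - C a).prod ∧ Multiset.card s = G.natDegree :=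
    ⟨_, _, (C_leadingCoeff_mul_prod_multiset_X_sub_C
      (splits_iff_card_roots.1 (IsAlgClosed.splits _))).symm, by
      rw [splits_iff_card_roots.1 (IsAlgClosed.splits _), natDegree_map_eq_of_injective hinj]⟩
  -- The leading constant c of G is absorbed into the cofactor.
  have h1 := sum_norm_coeff_mul_derivative_prod_le (f := f.map φ)
    ((Polynomial.map_ne_zero_iff hinj).2 hf) (N := N)
    (by rw [natDegree_map_eq_of_injective hinj, hN]) s (q.map φ * C c) (by
      rw [h, Polynomial.map_mul, hGs.1]; ring)
  have h2 : q.map φ * C c * derivative (s.map fun a => X - C a).prod =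
      (q * derivative G).map φ := by
    rw [Polynomial.map_mul, ← derivative_map, hGs.1, derivative_C_mul, mul_assoc]
  have hle : (G.natDegree : ℝ) ≤ f.natDegree := by
    exact_mod_cast natDegree_le_of_dvd ⟨q, h⟩ hf
  rw [h2, hGs.2] at h1
  have h3 : ∀ i, ‖((q * derivative G).map φ).coeff i‖ = |((q * derivative G).coeff i : ℝ)| := by
    intro i
    rw [coeff_map]
    simp [hφ]
  simp only [h3] at h1
  rw [hN, Nat.add_sub_cancel, ← hN]
  rw [← hN] at h1
  refine h1.trans (mul_le_mul hle ?_
    (mul_nonneg (by positivity) (mahlerMeasure_nonneg _)) (by positivity))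
  exact mul_le_mul_of_nonneg_left (mahlerMeasure_map_le_polyNorm f) (by positivity)

theorem norm_eval_le (u : ℂ[X]) (a : ℂ) :
    ‖u.eval a‖ ≤ max 1 ‖a‖ ^ u.natDegree * ∑ i ∈ Finset.range (u.natDegree + 1), ‖u.coeff i‖ := by
  rw [eval_eq_sum_range, Finset.mul_sum]
  refine (norm_sum_le _ _).trans (Finset.sum_le_sum fun i hi => ?_)
  rw [norm_mul, norm_pow, mul_comm]
  refine mul_le_mul_of_nonneg_right ?_ (norm_nonneg _)
  calc ‖a‖ ^ i ≤ max 1 ‖a‖ ^ i := by gcongr; exact le_max_right _ _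
    _ ≤ _ := pow_le_pow_right₀ (le_max_left _ _) (by simpa [Nat.lt_succ_iff] using hi)

/-- The resultant is lc(g)^(deg u) ∏ u(a) over the roots a of g, with |u(a)| ≤ max(1, |a|)^(deg u)
‖u‖₁; the factors max(1, |a|) and lc(g) assemble to the Mahler measure. -/
theorem norm_resultant_le (g u : ℂ[X]) :
    ‖resultant g u‖ ≤ g.mahlerMeasure ^ u.natDegree *
      (∑ i ∈ Finset.range (u.natDegree + 1), ‖u.coeff i‖) ^ g.natDegree := by
  set S := ∑ i ∈ Finset.range (u.natDegree + 1), ‖u.coeff i‖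
  have hs := IsAlgClosed.splits g
  rw [resultant_eq_prod_eval g u _ le_rfl hs, norm_mul, norm_pow,
    mahlerMeasure_eq_leadingCoeff_mul_prod_roots, mul_pow, mul_assoc]
  refine mul_le_mul_of_nonneg_left ?_ (by positivity)
  have h1 : ‖(g.roots.map u.eval).prod‖ = (g.roots.map fun a => ‖u.eval a‖).prod := by
    simpa using map_multiset_prod (normHom : ℂ →*₀ ℝ) (g.roots.map u.eval)
  rw [h1]
  calc _ ≤ (g.roots.map fun a => max 1 ‖a‖ ^ u.natDegree * S).prod :=
        Multiset.prod_map_le_prod_map₀ _ _ (fun a _ => norm_nonneg _) fun a _ => norm_eval_le u a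
    _ = _ := by
      rw [Multiset.prod_map_mul, Multiset.prod_map_pow, Multiset.map_const', Multiset.prod_replicate,
        splits_iff_card_roots.1 hs]

theorem abs_resultant_le (g u : ℤ[X]) :
    |((resultant g u : ℤ) : ℝ)| ≤ (g.map (Int.castRingHom ℂ)).mahlerMeasure ^ u.natDegree *
      (∑ i ∈ Finset.range (u.natDegree + 1), |(u.coeff i : ℝ)|) ^ g.natDegree := by
  have hinj : Function.Injective (Int.castRingHom ℂ) := RingHom.injective_int _
  have h := norm_resultant_le (g.map (Int.castRingHom ℂ)) (u.map (Int.castRingHom ℂ))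
  rw [resultant_map_map, natDegree_map_eq_of_injective hinj,
    natDegree_map_eq_of_injective hinj] at h
  simpa using h

theorem mahlerMeasure_map_le_of_eq_mul {f G q : ℤ[X]} (hf : f ≠ 0) (h : f = G * q) :
    (G.map (Int.castRingHom ℂ)).mahlerMeasure ≤ polyNorm f := by
  refine le_trans ?_ (mahlerMeasure_map_le_polyNorm f)
  rw [h, Polynomial.map_mul, mahlerMeasure_mul]
  refine le_mul_of_one_le_right (mahlerMeasure_nonneg _) (one_le_mahlerMeasure_of_ne_zero ?_)
  rintro rfl
  simp [h] at hf

theorem polyNorm_sq (f : ℤ[X]) :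
    polyNorm f ^ 2 = ∑ i ∈ Finset.range (f.natDegree + 1), (f.coeff i : ℝ) ^ 2 := by
  rw [polyNorm, Real.sq_sqrt (Finset.sum_nonneg fun _ _ => sq_nonneg _)]
  refine Finset.sum_subset (fun i hi => ?_) fun i _ hi => ?_
  · exact Finset.mem_range_succ_iff.2 (le_natDegree_of_mem_supp i hi)
  · simp [notMem_support_iff.1 hi]

theorem sq_sum_abs_le (N : ℕ) (a : ℕ → ℝ) :
    (∑ i ∈ Finset.range N, |a i|) ^ 2 ≤ N * ∑ i ∈ Finset.range N, a i ^ 2 := by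
  simpa using sq_sum_le_card_mul_sum_sq (s := Finset.range N) (f := fun i => |a i|)

theorem sum_abs_coeff_derivative_le (f : ℤ[X]) :
    ∑ i ∈ Finset.range f.natDegree, |((derivative f).coeff i : ℝ)| ≤
      f.natDegree * (Real.sqrt f.natDegree * polyNorm f) := by
  have h1 : (∑ i ∈ Finset.range f.natDegree, |(f.coeff (i + 1) : ℝ)|) ≤
      Real.sqrt f.natDegree * polyNorm f := by
    refine abs_le_of_sq_le_sq' ?_ (mul_nonneg (Real.sqrt_nonneg _) (polyNorm_nonneg f)) |>.2
    rw [mul_pow, Real.sq_sqrt (Nat.cast_nonneg _), polyNorm_sq]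
    refine (sq_sum_abs_le _ fun i => (f.coeff (i + 1) : ℝ)).trans ?_
    rw [Finset.sum_range_succ' _ f.natDegree]
    gcongr
    exact le_add_of_nonneg_right (sq_nonneg _)
  refine le_trans ?_ (mul_le_mul_of_nonneg_left h1 (Nat.cast_nonneg _))
  rw [Finset.mul_sum]
  refine Finset.sum_le_sum fun i hi => ?_
  rw [coeff_derivative]
  push_cast
  rw [abs_mul, mul_comm]
  refine mul_le_mul_of_nonneg_right ?_ (abs_nonneg _)
  rw [abs_of_nonneg (by positivity)]
  exact_mod_cast Finset.mem_range.1 hi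

end Bounds

/-! ### Monic divisors of a squarefree product of irreducibles. -/

section Divisors

variable {K : Type*} [Field K] {r : ℕ} {P : Fin r → K[X]}

theorem exists_eq_prod_of_monic_of_dvd_prod (hm : ∀ i, (P i).Monic)
    (hi : ∀ i, Irreducible (P i)) (s : Finset (Fin r)) :
    ∀ h : K[X], h.Monic → h ∣ ∏ i ∈ s, P i → ∃ t ⊆ s, h = ∏ i ∈ t, P i := by
  classical
  induction s using Finset.induction_on with
  | empty =>
    intro h hh hd
    rw [Finset.prod_empty] at hd
    exact ⟨∅, le_rfl, by simpa using hh.eq_one_of_isUnit (isUnit_of_dvd_one hd)⟩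
  | insert a s ha ih =>
    intro h hh hd
    rw [Finset.prod_insert ha] at hd
    by_cases hah : P a ∣ h
    · obtain ⟨h', rfl⟩ := hah
      obtain ⟨t, ht, rfl⟩ := ih h' ((hm a).of_mul_monic_left hh)
        ((mul_dvd_mul_iff_left (hm a).ne_zero).1 hd)
      exact ⟨insert a t, Finset.insert_subset_insert _ ht,
        (Finset.prod_insert fun h => ha (ht h)).symm⟩
    · obtain ⟨t, ht, rfl⟩ := ih h hh
        ((((hi a).coprime_iff_not_dvd.2 hah).symm).dvd_of_dvd_mul_left hd)
      exact ⟨t, ht.trans (Finset.subset_insert _ _), rfl⟩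

theorem injective_of_squarefree_prod (hi : ∀ i, Irreducible (P i))
    (hs : Squarefree (∏ i, P i)) : Function.Injective P := by
  classical
  intro i j h
  by_contra hij
  refine (hi i).not_isUnit (hs (P i) ?_)
  nth_rw 2 [h]
  rw [← Finset.prod_pair hij]
  exact Finset.prod_dvd_prod_of_subset _ _ _ (Finset.subset_univ _)

theorem exponent_le_one (hi : ∀ i, Irreducible (P i)) (hs : Squarefree (∏ i, P i))
    {e : Fin r → ℕ} (h : ∏ i, P i ^ e i ∣ ∏ i, P i) (i : Fin r) : e i ≤ 1 := by
  by_contra! hlt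
  refine (hi i).not_isUnit (hs (P i) (dvd_trans ?_ h))
  rw [← sq]
  exact (pow_dvd_pow _ hlt).trans (Finset.dvd_prod_of_mem _ (Finset.mem_univ i))

theorem dvd_prod_pow_iff (hm : ∀ i, (P i).Monic) (hi : ∀ i, Irreducible (P i))
    (hs : Squarefree (∏ i, P i)) (e : Fin r → ℕ) (i : Fin r) :
    P i ∣ ∏ j, P j ^ e j ↔ e i ≠ 0 := by
  constructor
  · intro h
    obtain ⟨j, -, hj⟩ := ((hi i).prime.dvd_finsetProd_iff _).1 h
    intro h0
    have hij : P i = P j := eq_of_monic_of_associated (hm i) (hm j)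
      ((hi i).associated_of_dvd (hi j) ((hi i).prime.dvd_of_dvd_pow hj))
    have := injective_of_squarefree_prod hi hs hij
    subst this
    rw [h0, pow_zero] at hj
    exact (hi i).not_isUnit (isUnit_of_dvd_one hj)
  · exact fun h => (dvd_pow_self _ h).trans (Finset.dvd_prod_of_mem _ (Finset.mem_univ i))

end Divisors

/-! ### Rational factors against local factors. -/

section LocalFactors

variable {p : ℕ} [Fact p.Prime] {f : ℤ[X]} {r : ℕ} {F : Fin r → ℤ_[p][X]}

/-- Clear denominators, take the primitive part, and apply Gauss's lemma. -/
theorem exists_integral_associate {f : ℤ[X]} {g : ℚ[X]} (hg : g ≠ 0)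
    (h : g ∣ f.map (Int.castRingHom ℚ)) :
    ∃ G q : ℤ[X], f = G * q ∧ ∃ c : ℚ, c ≠ 0 ∧ G.map (Int.castRingHom ℚ) = C c * g := by
  set N := IsLocalization.integerNormalization (nonZeroDivisors ℤ) g with hN
  have hN0 : N ≠ 0 := by
    rwa [hN, Ne, IsFractionRing.integerNormalization_eq_zero_iff]
  obtain ⟨b, hb, hbN⟩ := IsLocalization.integerNormalization_spec (nonZeroDivisors ℤ) g
  rw [← hN] at hbN
  have hb0 : b ≠ 0 := nonZeroDivisors.ne_zero hb
  have hc0 : N.content ≠ 0 := by simpa [content_eq_zero_iff] using hN0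
  have hmap : N.primPart.map (Int.castRingHom ℚ) = C ((b : ℚ) / N.content) * g := by
    have h1 : C (N.content : ℚ) * N.primPart.map (Int.castRingHom ℚ) = C (b : ℚ) * g := by
      have h2 := congrArg (Polynomial.map (Int.castRingHom ℚ)) N.eq_C_content_mul_primPart
      rw [Polynomial.map_mul, map_C] at h2
      rw [show C (N.content : ℚ) = C ((Int.castRingHom ℚ) N.content) from rfl, ← h2]
      refine hbN.trans ?_
      ext i
      simp
    have hc0' : (N.content : ℚ) ≠ 0 := by exact_mod_cast hc0
    rw [div_eq_inv_mul, C_mul, mul_assoc, ← h1, ← mul_assoc, ← C_mul, inv_mul_cancel₀ hc0', C_1,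
      one_mul]
  have hq0 : ((b : ℚ) / N.content) ≠ 0 :=
    div_ne_zero (by exact_mod_cast hb0) (by exact_mod_cast hc0)
  obtain ⟨q, hq⟩ := N.isPrimitive_primPart.dvd_of_fraction_map_dvd_fraction_map (K := ℚ) (q := f)
    (by
      change N.primPart.map (Int.castRingHom ℚ) ∣ f.map (Int.castRingHom ℚ)
      rw [hmap]
      exact (C_mul_dvd hq0).2 h)
  exact ⟨_, q, hq, _, hq0, hmap⟩

theorem IsLocalFactorization.irreducible_map (hF : IsLocalFactorization p f F) (j : Fin r) :
    Irreducible ((F j).map (algebraMap ℤ_[p] ℚ_[p])) :=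
  ((hF.monic j).irreducible_iff_irreducible_map_fraction_map).1 (hF.irreducible j)

theorem map_int_padic (f : ℤ[X]) :
    (f.map (Int.castRingHom ℤ_[p])).map (algebraMap ℤ_[p] ℚ_[p]) =
      (f.map (Int.castRingHom ℚ)).map (algebraMap ℚ ℚ_[p]) := by
  rw [Polynomial.map_map, Polynomial.map_map]
  congr 1

theorem IsLocalFactorization.map_eq (hF : IsLocalFactorization p f F) :
    (f.map (Int.castRingHom ℚ)).map (algebraMap ℚ ℚ_[p]) =
      C (f.leadingCoeff : ℚ_[p]) * ∏ j, (F j).map (algebraMap ℤ_[p] ℚ_[p]) := by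
  rw [← map_int_padic, hF.prod_eq, Polynomial.map_mul, Polynomial.map_prod, map_C]
  simp

theorem IsLocalFactorization.prod_map_dvd (hF : IsLocalFactorization p f F) :
    ∏ j, (F j).map (algebraMap ℤ_[p] ℚ_[p]) ∣
      (f.map (Int.castRingHom ℚ)).map (algebraMap ℚ ℚ_[p]) :=
  ⟨_, by rw [hF.map_eq, mul_comm]⟩

theorem IsLocalFactorization.dvd_prod_map (hF : IsLocalFactorization p f F) (hf : f ≠ 0) :
    (f.map (Int.castRingHom ℚ)).map (algebraMap ℚ ℚ_[p]) ∣
      ∏ j, (F j).map (algebraMap ℤ_[p] ℚ_[p]) := by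
  rw [hF.map_eq]
  exact (C_mul_dvd (by simpa using hf)).2 dvd_rfl

theorem IsLocalFactorization.squarefree (hF : IsLocalFactorization p f F)
    (hsep : (f.map (Int.castRingHom ℚ)).Separable) :
    Squarefree (∏ j, (F j).map (algebraMap ℤ_[p] ℚ_[p])) :=
  (hsep.map (f := algebraMap ℚ ℚ_[p])).squarefree.squarefree_of_dvd hF.prod_map_dvd

theorem IsRationalFactorVector.le_one {e : Fin r → ℕ} (he : IsRationalFactorVector p f F e)
    (hF : IsLocalFactorization p f F) (hf : f ≠ 0)
    (hsep : (f.map (Int.castRingHom ℚ)).Separable) (i : Fin r) : e i ≤ 1 := by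
  obtain ⟨g, -, -, hdvd, hge⟩ := he
  refine exponent_le_one hF.irreducible_map (hF.squarefree hsep) ?_ i
  rw [← hge]
  exact (Polynomial.map_dvd _ hdvd).trans (hF.dvd_prod_map hf)

/-- Distinct monic irreducibles are coprime over ℚ, hence over ℚ_p, and cannot share a local factor.
So supports of distinct exponent vectors are disjoint. -/
theorem IsRationalFactorVector.eq_of_ne_zero {e e' : Fin r → ℕ}
    (he : IsRationalFactorVector p f F e) (he' : IsRationalFactorVector p f F e')
    (hF : IsLocalFactorization p f F) (hf : f ≠ 0)
    (hsep : (f.map (Int.castRingHom ℚ)).Separable) {i : Fin r} (hi : e i ≠ 0) (hi' : e' i ≠ 0) :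
    e = e' := by
  have h1 := he.le_one hF hf hsep
  have h1' := he'.le_one hF hf hsep
  obtain ⟨g, hgm, hgi, hdvd, hge⟩ := he
  obtain ⟨g', hgm', hgi', hdvd', hge'⟩ := he'
  have hmon := fun j => (hF.monic j).map (algebraMap ℤ_[p] ℚ_[p])
  have key := dvd_prod_pow_iff hmon hF.irreducible_map (hF.squarefree hsep)
  have hgg : g = g' := by
    rcases (dvd_or_isCoprime g g' hgi) with h | h
    · exact eq_of_monic_of_associated hgm hgm' (hgi.associated_of_dvd hgi' h)
    · have h2 := h.map (mapRingHom (algebraMap ℚ ℚ_[p]))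
      simp only [coe_mapRingHom, hge, hge'] at h2
      exact absurd (h2.isUnit_of_dvd' ((key e i).2 hi) ((key e' i).2 hi'))
        (hF.irreducible_map i).not_isUnit
  subst hgg
  funext j
  have h3 := key e j
  rw [← hge, hge', key] at h3
  have := h1 j
  have := h1' j
  omega

theorem exists_monic_irreducible_dvd_of_prime_dvd_map {K L : Type*} [Field K] [Field L]
    (φ : K →+* L) {h : K[X]} (hh : h ≠ 0) {π : L[X]} (hπ : Prime π) (hdvd : π ∣ h.map φ) :
    ∃ g : K[X], g.Monic ∧ Irreducible g ∧ g ∣ h ∧ π ∣ g.map φ := by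
  classical
  have h2 : h ∣ (UniqueFactorizationMonoid.normalizedFactors h).prod :=
    (UniqueFactorizationMonoid.prod_normalizedFactors hh).symm.dvd
  have h3 := hdvd.trans (Polynomial.map_dvd φ h2)
  rw [← coe_mapRingHom, map_multiset_prod] at h3
  obtain ⟨g, hg, hig⟩ := hπ.exists_mem_multiset_map_dvd h3
  have hgi := UniqueFactorizationMonoid.irreducible_of_normalized_factor g hg
  refine ⟨g, ?_, hgi, UniqueFactorizationMonoid.dvd_of_mem_normalizedFactors hg, hig⟩
  rw [← UniqueFactorizationMonoid.normalize_normalized_factor g hg]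
  exact monic_normalize hgi.ne_zero

theorem prod_eq_prod_pow_indicator {M : Type*} [CommMonoid M] {r : ℕ} (P : Fin r → M)
    (t : Finset (Fin r)) : ∏ i ∈ t, P i = ∏ i, P i ^ (if i ∈ t then 1 else 0) := by
  simp [Finset.prod_ite_mem, pow_ite]

theorem IsLocalFactorization.exists_vector (hF : IsLocalFactorization p f F) (hf : f ≠ 0)
    (hsep : (f.map (Int.castRingHom ℚ)).Separable) (i : Fin r) :
    ∃ e, IsRationalFactorVector p f F e ∧ e i ≠ 0 := by
  have hmon := fun j => (hF.monic j).map (algebraMap ℤ_[p] ℚ_[p])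
  have hf0 : f.map (Int.castRingHom ℚ) ≠ 0 :=
    (Polynomial.map_ne_zero_iff (RingHom.injective_int _)).2 hf
  have hi : (F i).map (algebraMap ℤ_[p] ℚ_[p]) ∣
      (f.map (Int.castRingHom ℚ)).map (algebraMap ℚ ℚ_[p]) :=
    (Finset.dvd_prod_of_mem (fun j => (F j).map (algebraMap ℤ_[p] ℚ_[p]))
      (Finset.mem_univ i)).trans hF.prod_map_dvd
  obtain ⟨g, hgm, hgi, hgd, hig⟩ := exists_monic_irreducible_dvd_of_prime_dvd_map
    (algebraMap ℚ ℚ_[p]) hf0 (hF.irreducible_map i).prime hi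
  have hgd' := (Polynomial.map_dvd (algebraMap ℚ ℚ_[p]) hgd).trans (hF.dvd_prod_map hf)
  obtain ⟨t, -, ht⟩ := exists_eq_prod_of_monic_of_dvd_prod hmon hF.irreducible_map Finset.univ
    (g.map (algebraMap ℚ ℚ_[p])) (hgm.map _) hgd'
  rw [prod_eq_prod_pow_indicator] at ht
  rw [ht] at hig
  exact ⟨fun j => if j ∈ t then 1 else 0, ⟨g, hgm, hgi, hgd, ht⟩,
    (dvd_prod_pow_iff hmon hF.irreducible_map (hF.squarefree hsep) _ i).1 hig⟩

end LocalFactors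

/-! ### Divisibility and vanishing of resultants. -/

section Resultant

/-- Reduce the Bézout identity Res = g a + u b modulo F: only c w b survives on the right, and the
constant Res is its own remainder because deg F > 0. Compare constant coefficients. -/
theorem dvd_resultant {R : Type*} [CommRing R] [Nontrivial R] {F : R[X]} (hF : F.Monic)
    (hdeg : F.natDegree ≠ 0) {c : R} {g u q w : R[X]} (hFg : F ∣ g) (hu : u = F * q + C c * w)
    (hg : g.natDegree ≠ 0) : c ∣ resultant g u := by
  obtain ⟨a, b, -, -, hab⟩ := exists_mul_add_mul_eq_C_resultant (m := g.natDegree)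
    (n := u.natDegree) g u le_rfl le_rfl (Or.inl hg)
  obtain ⟨g', rfl⟩ := hFg
  have h1 : C (resultant (F * g') u) = c • (w * b) + F * (g' * a + q * b) := by
    rw [← hab, smul_eq_C_mul]
    linear_combination b * hu
  have h2 := congrArg (· %ₘ F) h1
  simp only [add_modByMonic, smul_modByMonic] at h2
  rw [(modByMonic_eq_zero_iff_dvd hF).2 (dvd_mul_right F _), add_zero,
    (modByMonic_eq_self_iff hF).2] at h2
  · have h3 := congrArg (fun P => P.coeff 0) h2
    simp only [coeff_C_zero, coeff_smul, smul_eq_mul] at h3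
    exact ⟨_, h3⟩
  · exact degree_C_le.trans_lt (natDegree_pos_iff_degree_pos.1 (Nat.pos_of_ne_zero hdeg))

theorem map_dvd_map_of_resultant_eq_zero {G u : ℤ[X]} {g : ℚ[X]} (hg : Irreducible g) {c : ℚ}
    (hc : c ≠ 0) (hG : G.map (Int.castRingHom ℚ) = C c * g) (h : resultant G u = 0) :
    g ∣ u.map (Int.castRingHom ℚ) := by
  have hinj : Function.Injective (Int.castRingHom ℚ) := RingHom.injective_int _
  have h1 : resultant (G.map (Int.castRingHom ℚ)) (u.map (Int.castRingHom ℚ)) = 0 := by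
    rw [resultant_map_map, natDegree_map_eq_of_injective hinj,
      natDegree_map_eq_of_injective hinj, h, map_zero]
  have h2 := (resultant_eq_zero_iff.1 h1).2
  rcases dvd_or_isCoprime g (u.map (Int.castRingHom ℚ)) hg with h3 | h3
  · exact h3
  · refine absurd ?_ h2
    rw [hG]
    exact (isCoprime_mul_unit_left_left (isUnit_C.2 hc.isUnit) _ _).2 h3

end Resultant

/-! ### The polynomials Φ(F_j) and logarithmic derivatives. -/

section Phi

variable {p : ℕ} [Fact p.Prime] {f : ℤ[X]} {r : ℕ} {F : Fin r → ℤ_[p][X]}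

theorem IsLocalFactorization.dvd_map (hF : IsLocalFactorization p f F) (j : Fin r) :
    F j ∣ f.map (Int.castRingHom ℤ_[p]) := by
  rw [hF.prod_eq]
  exact (Finset.dvd_prod_of_mem F (Finset.mem_univ j)).trans (dvd_mul_left _ _)

theorem IsLocalFactorization.Phi_eq (hF : IsLocalFactorization p f F) (j : Fin r) :
    Phi (f.map (Int.castRingHom ℤ_[p])) (F j) =
      C (f.leadingCoeff : ℤ_[p]) * (∏ i ∈ Finset.univ.erase j, F i) * derivative (F j) := by
  refine mul_right_cancel₀ (hF.monic j).ne_zero ?_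
  rw [Phi_mul_self (hF.monic j) (hF.dvd_map j)]
  nth_rw 1 [hF.prod_eq, ← Finset.mul_prod_erase _ _ (Finset.mem_univ j)]
  ring

theorem IsLocalFactorization.derivative_eq_sum (hF : IsLocalFactorization p f F) :
    (derivative f).map (Int.castRingHom ℤ_[p]) =
      ∑ j, Phi (f.map (Int.castRingHom ℤ_[p])) (F j) := by
  rw [← derivative_map]
  nth_rw 1 [hF.prod_eq]
  rw [derivative_C_mul, derivative_prod_finset, Finset.mul_sum]
  refine Finset.sum_congr rfl fun j _ => ?_
  rw [hF.Phi_eq, mul_assoc]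

theorem IsLocalFactorization.dvd_Phi (hF : IsLocalFactorization p f F) {i j : Fin r}
    (h : i ≠ j) : F i ∣ Phi (f.map (Int.castRingHom ℤ_[p])) (F j) := by
  rw [hF.Phi_eq]
  exact ((Finset.dvd_prod_of_mem F (Finset.mem_erase.2 ⟨h, Finset.mem_univ i⟩)).trans
    (dvd_mul_left _ _)).trans (dvd_mul_right _ _)

theorem IsLocalFactorization.natDegree_ne_zero (hF : IsLocalFactorization p f F) (j : Fin r) :
    (F j).natDegree ≠ 0 := fun h =>
  (hF.irreducible j).not_isUnit (eq_one_of_monic_natDegree_zero (hF.monic j) h ▸ isUnit_one)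

theorem natDegree_map_padic (f : ℤ[X]) :
    (f.map (Int.castRingHom ℤ_[p])).natDegree = f.natDegree :=
  natDegree_map_eq_of_injective (RingHom.injective_int _) f

theorem IsLocalFactorization.card_le_natDegree (hF : IsLocalFactorization p f F) (hf : f ≠ 0) :
    r ≤ f.natDegree := by
  have h1 : f.natDegree = ∑ j, (F j).natDegree := by
    rw [← natDegree_map_padic (p := p), hF.prod_eq, natDegree_C_mul (by simpa using hf),
      natDegree_prod_of_monic _ _ fun j _ => hF.monic j]
  rw [h1]
  calc r = ∑ _j : Fin r, 1 := by simp
    _ ≤ _ := Finset.sum_le_sum fun j _ => Nat.one_le_iff_ne_zero.2 (hF.natDegree_ne_zero j)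

theorem IsLocalFactorization.natDegree_Phi_lt (hF : IsLocalFactorization p f F) (j : Fin r)
    (hf : f.natDegree ≠ 0) :
    (Phi (f.map (Int.castRingHom ℤ_[p])) (F j)).natDegree < f.natDegree := by
  rw [Phi, natDegree_divByMonic _ (hF.monic j)]
  have h1 := natDegree_mul_le (p := f.map (Int.castRingHom ℤ_[p])) (q := derivative (F j))
  have h2 := natDegree_derivative_lt (hF.natDegree_ne_zero j)
  rw [natDegree_map_padic] at h1
  omega

/-- The logarithmic derivative of a product of powers. -/
theorem mul_derivative_prod_pow {R : Type*} [CommRing R] {r : ℕ} (f : R[X]) (P Q : Fin r → R[X])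
    (h : ∀ j, Q j * P j = f * derivative (P j)) (e : Fin r → ℕ) (s : Finset (Fin r)) :
    f * derivative (∏ j ∈ s, P j ^ e j) = (∏ j ∈ s, P j ^ e j) * ∑ j ∈ s, (e j : R[X]) * Q j := by
  classical
  induction s using Finset.induction_on with
  | empty => simp
  | insert a s ha ih =>
    rw [Finset.prod_insert ha, Finset.sum_insert ha, derivative_mul, mul_add,
      mul_left_comm f (P a ^ e a), ih]
    have h1 : f * derivative (P a ^ e a) = P a ^ e a * (e a * Q a) := by
      rcases Nat.eq_zero_or_pos (e a) with h0 | h0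
      · simp [h0]
      · rw [derivative_pow, ← Nat.sub_add_cancel h0, pow_succ]
        simp only [Nat.add_sub_cancel, map_natCast]
        linear_combination (-((e a - 1 + 1 : ℕ) : R[X]) * P a ^ (e a - 1)) * h a
    rw [← mul_assoc f, h1]
    ring

end Phi

/-! ### Lattice membership as a congruence of polynomials modulo p^l. -/

section LatticeMembership

theorem mem_allCoeffLattice_iff {p l r n : ℕ} {A : Matrix (Fin n) (Fin r) ℤ} {v : Fin r ⊕ Fin n → ℤ} :
    v ∈ allCoeffLattice p l A ↔
      ∀ i, (p : ℤ) ^ l ∣ v (Sum.inr i) - ∑ j, A i j * v (Sum.inl j) := by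
  rw [allCoeffLattice, ← Matrix.range_mulVecLin]
  constructor
  · rintro ⟨x, rfl⟩ i
    rw [Matrix.mulVecLin_apply, Matrix.fromBlocks_mulVec, Matrix.smul_mulVec,
      Matrix.one_mulVec]
    simp [Matrix.mulVec, dotProduct]
  · intro h
    choose z hz using h
    refine ⟨Sum.elim (fun j => v (Sum.inl j)) z, ?_⟩
    rw [Matrix.mulVecLin_apply, Matrix.fromBlocks_mulVec, Matrix.smul_mulVec,
      Matrix.one_mulVec]
    ext (j | i)
    · simp
    · have := hz i
      simp [Matrix.mulVec, dotProduct] at this ⊢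
      linarith

variable {p : ℕ} [Fact p.Prime] {f : ℤ[X]} {r n l : ℕ} {F : Fin r → ℤ_[p][X]}
  {A : Matrix (Fin n) (Fin r) ℤ}

/-- The polynomial whose coefficients are the last `n` entries of a vector. -/
noncomputable def tailPoly (v : Fin r ⊕ Fin n → ℤ) : ℤ[X] :=
  ∑ i : Fin n, C (v (Sum.inr i)) * X ^ (i : ℕ)

theorem coeff_tailPoly (v : Fin r ⊕ Fin n → ℤ) (k : ℕ) :
    (tailPoly v).coeff k = if h : k < n then v (Sum.inr ⟨k, h⟩) else 0 := by
  simp only [tailPoly, finsetSum_coeff, coeff_C_mul, coeff_X_pow, mul_ite, mul_one, mul_zero]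
  split_ifs with h
  · rw [Finset.sum_eq_single ⟨k, h⟩]
    · simp
    · intro j _ hj
      rw [if_neg]
      rintro rfl
      exact hj rfl
    · simp
  · refine Finset.sum_eq_zero fun i _ => if_neg ?_
    have := i.2
    omega

theorem IsCoeffMatrix.mem_allCoeffLattice_iff (hA : IsCoeffMatrix p l f F A)
    (v : Fin r ⊕ Fin n → ℤ) :
    v ∈ allCoeffLattice p l A ↔ ∀ i : Fin n, (p : ℤ_[p]) ^ l ∣ (v (Sum.inr i) : ℤ_[p]) -
      (∑ j, C (v (Sum.inl j) : ℤ_[p]) * Phi (f.map (Int.castRingHom ℤ_[p])) (F j)).coeff i := by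
  rw [AllCoefficients.mem_allCoeffLattice_iff]
  refine forall_congr' fun i => ?_
  rw [← PadicInt.pow_p_dvd_int_iff]
  have h1 : (p : ℤ_[p]) ^ l ∣ ∑ j, ((A i j : ℤ_[p]) -
      (Phi (f.map (Int.castRingHom ℤ_[p])) (F j)).coeff i) * (v (Sum.inl j) : ℤ_[p]) :=
    Finset.dvd_sum fun j _ => (hA i j).mul_right _
  rw [← dvd_add_left h1]
  have h2 : ((v (Sum.inr i) - ∑ j, A i j * v (Sum.inl j) : ℤ) : ℤ_[p]) +
      ∑ j, ((A i j : ℤ_[p]) - (Phi (f.map (Int.castRingHom ℤ_[p])) (F j)).coeff i) *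
        (v (Sum.inl j) : ℤ_[p]) = (v (Sum.inr i) : ℤ_[p]) -
      (∑ j, C (v (Sum.inl j) : ℤ_[p]) *
        Phi (f.map (Int.castRingHom ℤ_[p])) (F j)).coeff i := by
    simp only [finsetSum_coeff, coeff_C_mul, sub_mul, Finset.sum_sub_distrib]
    push_cast
    rw [sub_add_sub_cancel]
    simp only [mul_comm]
  rw [h2]

/-- Modulo p^l the left side is ∑ (v_j - v_i) Φ(F_j): the term j = i vanishes and F_i divides all
others. -/
theorem IsCoeffMatrix.exists_eq (hA : IsCoeffMatrix p l f F A)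
    (hF : IsLocalFactorization p f F) (hn : f.natDegree = n) (hn0 : n ≠ 0)
    {v : Fin r ⊕ Fin n → ℤ} (hv : v ∈ allCoeffLattice p l A) (i : Fin r) :
    ∃ q w : ℤ_[p][X], (tailPoly v - C (v (Sum.inl i)) * derivative f).map (Int.castRingHom ℤ_[p]) =
      F i * q + C ((p : ℤ_[p]) ^ l) * w := by
  set Ψ := fun j => Phi (f.map (Int.castRingHom ℤ_[p])) (F j) with hΨ
  obtain ⟨w, hw⟩ : C ((p : ℤ_[p]) ^ l) ∣ (tailPoly v).map (Int.castRingHom ℤ_[p]) -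
      ∑ j, C (v (Sum.inl j) : ℤ_[p]) * Ψ j := by
    rw [C_dvd_iff_dvd_coeff]
    intro k
    rw [coeff_sub, coeff_map, coeff_tailPoly]
    split_ifs with hk
    · exact (hA.mem_allCoeffLattice_iff v).1 hv ⟨k, hk⟩
    · rw [finsetSum_coeff, Finset.sum_eq_zero]
      · simp
      · intro j _
        rw [coeff_C_mul, coeff_eq_zero_of_natDegree_lt, mul_zero]
        exact (hF.natDegree_Phi_lt j (by omega)).trans_le (by omega)
  obtain ⟨q, hq⟩ : F i ∣ ∑ j, C ((v (Sum.inl j) - v (Sum.inl i) : ℤ) : ℤ_[p]) * Ψ j := by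
    refine Finset.dvd_sum fun j _ => ?_
    by_cases hij : i = j
    · simp [hij]
    · exact (hF.dvd_Phi hij).trans (dvd_mul_left _ _)
  refine ⟨q, w, ?_⟩
  rw [← hq, ← hw, Polynomial.map_sub, Polynomial.map_mul, hF.derivative_eq_sum, map_C,
    Finset.mul_sum]
  simp only [Int.cast_sub, C_sub, sub_mul, Finset.sum_sub_distrib, hΨ, eq_intCast]
  ring

end LatticeMembership

/-! ### Short vectors, the vanishing resultant, and the two inclusions. -/

section Main

variable {p : ℕ} [Fact p.Prime] {f : ℤ[X]} {r n l : ℕ} {F : Fin r → ℤ_[p][X]}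
  {A : Matrix (Fin n) (Fin r) ℤ}

theorem boundB'_nonneg (f : ℤ[X]) (r : ℕ) : 0 ≤ boundB' f r := Real.sqrt_nonneg _

theorem boundB_le_boundB' (f : ℤ[X]) (r : ℕ) : boundB f ≤ boundB' f r :=
  Real.le_sqrt_of_sq_le (le_add_of_nonneg_left (sq_nonneg _))

theorem IsLocalFactorization.map_mul_derivative_eq_sum (hF : IsLocalFactorization p f F)
    {e : Fin r → ℕ} {g : ℚ[X]} (hg : g ≠ 0)
    (hge : g.map (algebraMap ℚ ℚ_[p]) = ∏ i, ((F i).map (algebraMap ℤ_[p] ℚ_[p])) ^ e i)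
    {G q : ℤ[X]} (hf : f = G * q) {c : ℚ} (hc : c ≠ 0)
    (hG : G.map (Int.castRingHom ℚ) = C c * g) :
    (q * derivative G).map (Int.castRingHom ℤ_[p]) =
      ∑ j, C (e j : ℤ_[p]) * Phi (f.map (Int.castRingHom ℤ_[p])) (F j) := by
  have hinj : Function.Injective (algebraMap ℤ_[p] ℚ_[p]) := IsFractionRing.injective _ _
  refine map_injective _ hinj ?_
  have hg0 : g.map (algebraMap ℚ ℚ_[p]) ≠ 0 := by
    rwa [Polynomial.map_ne_zero_iff (RingHom.injective _)]
  refine mul_left_cancel₀ hg0 ?_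
  have h1 := mul_derivative_prod_pow ((f.map (Int.castRingHom ℤ_[p])).map (algebraMap ℤ_[p] ℚ_[p]))
    (fun j => (F j).map (algebraMap ℤ_[p] ℚ_[p]))
    (fun j => (Phi (f.map (Int.castRingHom ℤ_[p])) (F j)).map (algebraMap ℤ_[p] ℚ_[p]))
    (fun j => by
      rw [derivative_map, ← Polynomial.map_mul, ← Polynomial.map_mul,
        Phi_mul_self (hF.monic j) (hF.dvd_map j)]) e Finset.univ
  rw [← hge] at h1
  have h2 : f.map (Int.castRingHom ℚ) * derivative g =
      g * (q * derivative G).map (Int.castRingHom ℚ) := by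
    have hc' : (C c : ℚ[X]) ≠ 0 := C_ne_zero.2 hc
    refine mul_left_cancel₀ hc' ?_
    rw [hf, Polynomial.map_mul, Polynomial.map_mul, ← derivative_map, hG, derivative_C_mul]
    ring
  have h3 := congrArg (Polynomial.map (algebraMap ℚ ℚ_[p])) h2
  rw [Polynomial.map_mul, Polynomial.map_mul, ← derivative_map, ← map_int_padic, h1,
    ← map_int_padic] at h3
  rw [← h3, Polynomial.map_sum]
  congr 1
  refine Finset.sum_congr rfl fun j _ => ?_
  rw [Polynomial.map_mul, map_C]
  simp

theorem IsCoeffMatrix.exists_short_vector (hA : IsCoeffMatrix p l f F A)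
    (hF : IsLocalFactorization p f F) (hn : f.natDegree = n) (hf : f ≠ 0)
    (hsep : (f.map (Int.castRingHom ℚ)).Separable) {e : Fin r → ℕ}
    (he : IsRationalFactorVector p f F e) :
    ∃ v ∈ allCoeffLattice p l A, ‖toEuclid v‖ ≤ boundB' f r ∧
      ∀ j, v (Sum.inl j) = (e j : ℤ) := by
  have he1 := he.le_one hF hf hsep
  obtain ⟨g, hgm, -, hdvd, hge⟩ := he
  obtain ⟨G, q, hGq, c, hc, hG⟩ := exists_integral_associate hgm.ne_zero hdvd
  set H := q * derivative G with hH
  refine ⟨Sum.elim (fun j => (e j : ℤ)) fun i => H.coeff i, ?_, ?_, fun j => rfl⟩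
  · rw [hA.mem_allCoeffLattice_iff]
    intro i
    have h1 := hF.map_mul_derivative_eq_sum hgm.ne_zero hge hGq hc hG
    simp only [Sum.elim_inl, Sum.elim_inr, Int.cast_natCast]
    rw [← h1, coeff_map]
    simp [hH]
  · refine Real.le_sqrt_of_sq_le ?_
    rw [norm_toEuclid_sq, Fintype.sum_sum_type]
    simp only [Sum.elim_inl, Sum.elim_inr, Int.cast_natCast]
    refine add_le_add ?_ ?_
    · calc ∑ j, (e j : ℝ) ^ 2 ≤ ∑ _j : Fin r, (1 : ℝ) := by
            refine Finset.sum_le_sum fun j _ => pow_le_one₀ (by positivity) ?_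
            exact_mod_cast he1 j
        _ = r := by simp
        _ ≤ (r : ℝ) ^ 2 := by exact_mod_cast Nat.le_self_pow (by norm_num) r
    · have h2 := sum_abs_coeff_mul_derivative_le hf hGq
      rw [← hH, hn] at h2
      rw [Fin.sum_univ_eq_sum_range (fun i => (H.coeff i : ℝ) ^ 2) n]
      calc _ = ∑ i ∈ Finset.range n, |(H.coeff i : ℝ)| ^ 2 := by simp only [sq_abs]
        _ ≤ (∑ i ∈ Finset.range n, |(H.coeff i : ℝ)|) ^ 2 :=
            Finset.sum_sq_le_sq_sum_of_nonneg fun i _ => abs_nonneg _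
        _ ≤ _ := by
            refine pow_le_pow_left₀ (Finset.sum_nonneg fun i _ => abs_nonneg _) (h2.trans_eq ?_) 2
            rw [boundB, hn]
            ring

theorem sum_abs_coeff_tailPoly_sub_le (hn : f.natDegree = n) (hn1 : 1 < n) {B : ℝ} (hB : 0 ≤ B)
    {v : Fin r ⊕ Fin n → ℤ} (hv : ‖toEuclid v‖ ^ 2 ≤ 2 ^ (2 * n - 1) * B ^ 2) (i : Fin r) :
    ∑ k ∈ Finset.range n, |((tailPoly v - C (v (Sum.inl i)) * derivative f).coeff k : ℝ)| ≤
      n * 2 ^ (n - 1) * B * (1 + n * polyNorm f) := by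
  have hF0 := polyNorm_nonneg f
  have hT0 : 0 ≤ (n : ℝ) * 2 ^ (n - 1) * B := by positivity
  have hn2 : (2 : ℝ) ≤ n := by exact_mod_cast hn1
  -- The odd factor 2 in 2^(2n-1) is absorbed by 2 ≤ n.
  have hT : n * ‖toEuclid v‖ ^ 2 ≤ (n * 2 ^ (n - 1) * B) ^ 2 := by
    have h2 : (2 : ℝ) ^ (2 * n - 1) = 2 * (2 ^ (n - 1)) ^ 2 := by
      rw [← pow_mul, ← pow_succ']
      congr 1
      omega
    rw [h2] at hv
    calc _ ≤ n * (2 * (2 ^ (n - 1)) ^ 2 * B ^ 2) := by gcongr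
      _ = n * 2 * ((2 ^ (n - 1)) ^ 2 * B ^ 2) := by ring
      _ ≤ n * n * ((2 ^ (n - 1)) ^ 2 * B ^ 2) := by gcongr
      _ = _ := by ring
  have hsplit := norm_toEuclid_sq v
  rw [Fintype.sum_sum_type] at hsplit
  have h1 : ∑ k ∈ Finset.range n, |((tailPoly v).coeff k : ℝ)| ≤ n * 2 ^ (n - 1) * B := by
    refine abs_le_of_sq_le_sq' ?_ hT0 |>.2
    refine (sq_sum_abs_le _ fun k => ((tailPoly v).coeff k : ℝ)).trans (le_trans ?_ hT)
    gcongr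
    rw [← Fin.sum_univ_eq_sum_range (fun k => ((tailPoly v).coeff k : ℝ) ^ 2) n, hsplit]
    simp only [coeff_tailPoly, Fin.is_lt, dite_true, Fin.eta]
    exact le_add_of_nonneg_left (Finset.sum_nonneg fun _ _ => sq_nonneg _)
  -- The √n is the one that Cauchy–Schwarz produces in the ℓ¹ bound for f'.
  have h2 : |(v (Sum.inl i) : ℝ)| * Real.sqrt n ≤ n * 2 ^ (n - 1) * B := by
    refine abs_le_of_sq_le_sq' ?_ hT0 |>.2
    rw [mul_pow, Real.sq_sqrt (Nat.cast_nonneg _), mul_comm, sq_abs]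
    refine le_trans (mul_le_mul_of_nonneg_left ?_ (Nat.cast_nonneg n)) hT
    rw [hsplit]
    exact (Finset.single_le_sum (f := fun j => (v (Sum.inl j) : ℝ) ^ 2)
      (fun _ _ => sq_nonneg _) (Finset.mem_univ i)).trans
      (le_add_of_nonneg_right (Finset.sum_nonneg fun _ _ => sq_nonneg _))
  have h3 := sum_abs_coeff_derivative_le f
  rw [hn] at h3
  calc _ ≤ ∑ k ∈ Finset.range n, (|((tailPoly v).coeff k : ℝ)| +
        |(v (Sum.inl i) : ℝ)| * |((derivative f).coeff k : ℝ)|) := by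
        refine Finset.sum_le_sum fun k _ => ?_
        rw [coeff_sub, coeff_C_mul, Int.cast_sub, Int.cast_mul, ← abs_mul]
        exact abs_sub _ _
    _ = ∑ k ∈ Finset.range n, |((tailPoly v).coeff k : ℝ)| +
        |(v (Sum.inl i) : ℝ)| * ∑ k ∈ Finset.range n, |((derivative f).coeff k : ℝ)| := by
        rw [Finset.sum_add_distrib, Finset.mul_sum]
    _ ≤ n * 2 ^ (n - 1) * B + |(v (Sum.inl i) : ℝ)| * (n * (Real.sqrt n * polyNorm f)) := by
        gcongr
    _ = n * 2 ^ (n - 1) * B + (|(v (Sum.inl i) : ℝ)| * Real.sqrt n) * (n * polyNorm f) := by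
        ring
    _ ≤ n * 2 ^ (n - 1) * B + (n * 2 ^ (n - 1) * B) * (n * polyNorm f) := by gcongr
    _ = _ := by ring

theorem bound_le_of_one_lt (hn : f.natDegree = n) (hn1 : 1 < n) (hf : f ≠ 0) (r : ℕ) :
    n * 2 ^ (n - 1) * boundB' f r * (1 + n * polyNorm f) ≤
      (2 ^ (n - 1) + (n : ℝ)) * boundB' f r * (1 + boundB' f r) := by
  have hB := boundB'_nonneg f r
  have hBB := boundB_le_boundB' f r
  rw [boundB, hn] at hBB
  have hF := one_le_polyNorm hf
  have hy : (n : ℝ) ≤ 2 ^ (n - 1) := by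
    have := Nat.lt_two_pow_self (n := n - 1)
    exact_mod_cast (by omega : n ≤ 2 ^ (n - 1))
  set y : ℝ := 2 ^ (n - 1)
  have hn2 : (2 : ℝ) ≤ n := by exact_mod_cast hn1
  set N : ℝ := (n : ℝ)
  set z := N * polyNorm f with hz
  have hz1 : 1 ≤ z := by nlinarith
  have hy0 : 0 < y := by linarith
  -- Here y z is `boundB f`, so 1 + y z ≤ 1 + B'. After expansion, N y ≤ y² z suffices, from N ≤ y
  -- and z ≥ 1.
  have key : N * y * (1 + z) ≤ (y + N) * (1 + y * z) := by
    have h1 : N * y ≤ y * y * z := by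
      calc N * y ≤ y * y := by gcongr
        _ ≤ y * y * z := le_mul_of_one_le_right (by positivity) hz1
    nlinarith
  calc _ = N * y * (1 + z) * boundB' f r := by ring
    _ ≤ (y + N) * (1 + boundB' f r) * boundB' f r := by
      refine mul_le_mul_of_nonneg_right (key.trans ?_) hB
      refine mul_le_mul_of_nonneg_left ?_ (by linarith)
      rw [hz, ← mul_assoc]
      linarith
    _ = _ := by ring

theorem natDegree_tailPoly_sub_lt (hn : f.natDegree = n) (hn0 : n ≠ 0) (v : Fin r ⊕ Fin n → ℤ)
    (a : ℤ) : (tailPoly v - C a * derivative f).natDegree < n := by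
  have h1 : (tailPoly v).natDegree ≤ n - 1 := by
    refine natDegree_le_iff_coeff_eq_zero.2 fun k hk => ?_
    rw [coeff_tailPoly, dif_neg (by omega)]
  have h2 : (C a * derivative f).natDegree ≤ n - 1 :=
    (natDegree_C_mul_le _ _).trans (hn ▸ natDegree_derivative_le f)
  have := natDegree_sub_le_of_le h1 h2
  omega

theorem IsCoeffMatrix.pow_dvd_resultant (hA : IsCoeffMatrix p l f F A)
    (hF : IsLocalFactorization p f F) (hn : f.natDegree = n) (hn0 : n ≠ 0)
    {v : Fin r ⊕ Fin n → ℤ} (hv : v ∈ allCoeffLattice p l A) {G : ℤ[X]} (hG0 : G.natDegree ≠ 0)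
    {i : Fin r} (hFG : F i ∣ G.map (Int.castRingHom ℤ_[p])) :
    (p : ℤ) ^ l ∣ resultant G (tailPoly v - C (v (Sum.inl i)) * derivative f) := by
  obtain ⟨q, w, hqw⟩ := hA.exists_eq hF hn hn0 hv i
  generalize tailPoly v - C (v (Sum.inl i)) * derivative f = u at hqw ⊢
  have h1 := dvd_resultant (hF.monic i) (hF.natDegree_ne_zero i) hFG hqw
    (by rwa [natDegree_map_padic])
  rw [resultant_map_map, natDegree_map_padic, natDegree_map_padic, eq_intCast] at h1
  exact (PadicInt.pow_p_dvd_int_iff _ _).1 h1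

/-- Both bases are at least 1, so the exponents deg u and deg G can be raised to n. -/
theorem abs_resultant_le_pow (hn : f.natDegree = n) (hf : f ≠ 0) {G q u : ℤ[X]} (hGq : f = G * q)
    (hu : u.natDegree < n) {T : ℝ} (hT1 : 1 ≤ T)
    (hT : ∑ k ∈ Finset.range n, |(u.coeff k : ℝ)| ≤ T) :
    |((resultant G u : ℤ) : ℝ)| ≤ (polyNorm f * T) ^ n := by
  have hMF := mahlerMeasure_map_le_of_eq_mul hf hGq
  have hF1 := one_le_polyNorm hf
  have hGn : G.natDegree ≤ n := hn ▸ natDegree_le_of_dvd ⟨q, hGq⟩ hf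
  have hM0 := mahlerMeasure_nonneg (G.map (Int.castRingHom ℂ))
  have hS : ∑ k ∈ Finset.range (u.natDegree + 1), |(u.coeff k : ℝ)| ≤ T :=
    (Finset.sum_le_sum_of_subset_of_nonneg (Finset.range_mono hu)
      fun _ _ _ => abs_nonneg _).trans hT
  rw [mul_pow]
  refine (abs_resultant_le G u).trans (mul_le_mul ?_ ?_ (by positivity) (by positivity))
  · exact (pow_le_pow_left₀ hM0 hMF _).trans (pow_le_pow_right₀ hF1 hu.le)
  · exact (pow_le_pow_left₀ (Finset.sum_nonneg fun _ _ => abs_nonneg _) hS _).trans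
      (pow_le_pow_right₀ hT1 hGn)

theorem one_le_boundB' (hn : f.natDegree ≠ 0) (r : ℕ) : 1 ≤ boundB' f r := by
  have hf : f ≠ 0 := by
    rintro rfl
    exact hn natDegree_zero
  refine le_trans ?_ (boundB_le_boundB' f r)
  have h2 : (1 : ℝ) ≤ 2 ^ (f.natDegree - 1) := one_le_pow₀ (by norm_num)
  have h3 : (1 : ℝ) ≤ f.natDegree := by exact_mod_cast Nat.one_le_iff_ne_zero.2 hn
  exact one_le_mul_of_one_le_of_one_le (one_le_mul_of_one_le_of_one_le h2 h3) (one_le_polyNorm hf)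

theorem pow_lt_of_lt_rpow_div {x y : ℝ} (hx : 0 ≤ x) (hy : 0 ≤ y) {l n : ℕ} (hn : n ≠ 0)
    (h : x < y ^ ((l : ℝ) / (n : ℝ))) : x ^ n < y ^ l := by
  calc x ^ n < (y ^ ((l : ℝ) / (n : ℝ))) ^ n := pow_lt_pow_left₀ h hx hn
    _ = y ^ l := by
      rw [← Real.rpow_natCast, ← Real.rpow_mul hy, div_mul_cancel₀ _ (Nat.cast_ne_zero.2 hn),
        Real.rpow_natCast]

theorem IsCoeffMatrix.dvd_of_short (hA : IsCoeffMatrix p l f F A)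
    (hF : IsLocalFactorization p f F) (hn : f.natDegree = n) (hn1 : 1 < n)
    (hbound : polyNorm f * (2 ^ (n - 1) + (n : ℝ)) * boundB' f r * (1 + boundB' f r) <
      (p : ℝ) ^ ((l : ℝ) / (n : ℝ)))
    {v : Fin r ⊕ Fin n → ℤ} (hv : v ∈ allCoeffLattice p l A)
    (hvB : ‖toEuclid v‖ ^ 2 ≤ 2 ^ (2 * n - 1) * boundB' f r ^ 2)
    {g : ℚ[X]} (hgi : Irreducible g) (hgf : g ∣ f.map (Int.castRingHom ℚ)) {i : Fin r}
    (hig : (F i).map (algebraMap ℤ_[p] ℚ_[p]) ∣ g.map (algebraMap ℚ ℚ_[p])) :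
    g ∣ (tailPoly v - C (v (Sum.inl i)) * derivative f).map (Int.castRingHom ℚ) := by
  have hn0 : n ≠ 0 := by omega
  have hf : f ≠ 0 := by
    rintro rfl
    exact hn0 (by rw [← hn, natDegree_zero])
  obtain ⟨G, q, hGq, c, hc, hG⟩ := exists_integral_associate hgi.ne_zero hgf
  refine map_dvd_map_of_resultant_eq_zero hgi hc hG ?_
  have hG0 : G.natDegree ≠ 0 := by
    have h1 : (G.map (Int.castRingHom ℚ)).natDegree = G.natDegree :=
      natDegree_map_eq_of_injective (RingHom.injective_int _) G
    rw [← h1, hG, natDegree_C_mul hc]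
    exact hgi.natDegree_pos.ne'
  have hFG : F i ∣ G.map (Int.castRingHom ℤ_[p]) := by
    refine (hF.monic i).isPrimitive.dvd_of_fraction_map_dvd_fraction_map (K := ℚ_[p]) ?_
    rw [map_int_padic, hG, Polynomial.map_mul]
    exact hig.mul_left _
  have h1 := hA.pow_dvd_resultant hF hn hn0 hv hG0 hFG
  have hB1 : 1 ≤ boundB' f r := one_le_boundB' (hn ▸ hn0) r
  have hT1 : 1 ≤ (2 ^ (n - 1) + (n : ℝ)) * boundB' f r * (1 + boundB' f r) := by
    have h2 : (1 : ℝ) ≤ 2 ^ (n - 1) := one_le_pow₀ (by norm_num)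
    refine one_le_mul_of_one_le_of_one_le (one_le_mul_of_one_le_of_one_le ?_ hB1) ?_
    · linarith [(Nat.cast_nonneg n : (0 : ℝ) ≤ n)]
    · linarith
  have h2 := abs_resultant_le_pow hn hf hGq (natDegree_tailPoly_sub_lt hn hn0 v (v (Sum.inl i)))
    hT1 ((sum_abs_coeff_tailPoly_sub_le hn hn1 (boundB'_nonneg f r) hvB i).trans
      (bound_le_of_one_lt hn hn1 hf r))
  have h3 := pow_lt_of_lt_rpow_div (mul_nonneg (polyNorm_nonneg f) (zero_le_one.trans hT1))
    (Nat.cast_nonneg p) hn0 (by rwa [← mul_assoc, ← mul_assoc])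
  refine Int.eq_zero_of_abs_lt_dvd h1 ?_
  exact_mod_cast h2.trans_lt h3

theorem IsCoeffMatrix.apply_eq_apply_of_short (hA : IsCoeffMatrix p l f F A)
    (hF : IsLocalFactorization p f F) (hn : f.natDegree = n) (hn1 : 1 < n)
    (hsep : (f.map (Int.castRingHom ℚ)).Separable)
    (hbound : polyNorm f * (2 ^ (n - 1) + (n : ℝ)) * boundB' f r * (1 + boundB' f r) <
      (p : ℝ) ^ ((l : ℝ) / (n : ℝ)))
    {v : Fin r ⊕ Fin n → ℤ} (hv : v ∈ allCoeffLattice p l A)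
    (hvB : ‖toEuclid v‖ ^ 2 ≤ 2 ^ (2 * n - 1) * boundB' f r ^ 2)
    {e : Fin r → ℕ} (he : IsRationalFactorVector p f F e) {i k : Fin r} (hi : e i ≠ 0)
    (hk : e k ≠ 0) : v (Sum.inl i) = v (Sum.inl k) := by
  obtain ⟨g, hgm, hgi, hdvd, hge⟩ := he
  have key : ∀ j, e j ≠ 0 →
      (F j).map (algebraMap ℤ_[p] ℚ_[p]) ∣ g.map (algebraMap ℚ ℚ_[p]) := by
    intro j hj
    rw [hge]
    exact (dvd_pow_self _ hj).trans
      (Finset.dvd_prod_of_mem (fun j => (F j).map (algebraMap ℤ_[p] ℚ_[p]) ^ e j)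
        (Finset.mem_univ j))
  have h1 := hA.dvd_of_short hF hn hn1 hbound hv hvB hgi hdvd (key i hi)
  have h2 := hA.dvd_of_short hF hn hn1 hbound hv hvB hgi hdvd (key k hk)
  have h3 := dvd_sub h2 h1
  have h4 : (tailPoly v - C (v (Sum.inl k)) * derivative f).map (Int.castRingHom ℚ) -
      (tailPoly v - C (v (Sum.inl i)) * derivative f).map (Int.castRingHom ℚ) =
      C ((v (Sum.inl i) - v (Sum.inl k) : ℤ) : ℚ) * derivative (f.map (Int.castRingHom ℚ)) := by
    simp only [Polynomial.map_sub, Polynomial.map_mul, map_C, derivative_map, Int.cast_sub, C_sub,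
      eq_intCast (Int.castRingHom ℚ)]
    ring
  rw [h4] at h3
  by_contra hne
  have hne' : ((v (Sum.inl i) - v (Sum.inl k) : ℤ) : ℚ) ≠ 0 := by
    exact_mod_cast sub_ne_zero.2 hne
  exact hgi.not_isUnit (IsCoprime.isUnit_of_dvd' hsep hdvd
    ((isUnit_C.2 hne'.isUnit).dvd_mul_left.1 h3))

/-- The supports of the 0/1 exponent vectors partition the indices, so a is the sum of these vectors
weighted by its constant values. -/
theorem mem_factorLattice_of_const (hF : IsLocalFactorization p f F) (hf : f ≠ 0)
    (hsep : (f.map (Int.castRingHom ℚ)).Separable) {a : Fin r → ℤ}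
    (ha : ∀ e, IsRationalFactorVector p f F e → ∀ i k, e i ≠ 0 → e k ≠ 0 → a i = a k) :
    a ∈ factorLattice p f F := by
  classical
  choose E hE hEi using fun i => hF.exists_vector hf hsep i
  have hc : ∀ e : Fin r → ℕ, ∃ c : ℤ, ∀ i, E i = e → a i = c := by
    intro e
    by_cases h : ∃ i, E i = e
    · obtain ⟨i, rfl⟩ := h
      exact ⟨a i, fun k hk => ha _ (hE i) k i (hk ▸ hEi k) (hEi i)⟩
    · exact ⟨0, fun i hi => absurd ⟨i, hi⟩ h⟩
  choose c hc using hc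
  -- Summing over the image of `E` counts each rational factor once, although several local factors
  -- may select it.
  have hsum : a = ∑ e ∈ Finset.univ.image E, c e • fun i => (e i : ℤ) := by
    funext i
    rw [Finset.sum_apply, Finset.sum_eq_single (E i)]
    · have h1 := (hE i).le_one hF hf hsep i
      have h2 : E i i = 1 := by have := hEi i; omega
      simp [h2, hc (E i) i rfl]
    · intro e he hne
      obtain ⟨k, -, rfl⟩ := Finset.mem_image.1 he
      have h0 : E k i = 0 := by
        by_contra h
        exact hne ((hE k).eq_of_ne_zero (hE i) hF hf hsep h (hEi i))
      simp [h0]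
    · exact fun h => absurd (Finset.mem_image_of_mem E (Finset.mem_univ i)) h
  rw [hsum]
  refine Submodule.sum_mem _ fun e he => Submodule.smul_mem _ _ (Submodule.subset_span ?_)
  obtain ⟨k, -, rfl⟩ := Finset.mem_image.1 he
  exact ⟨_, hE k, rfl⟩

end Main

end AllCoefficients

theorem mainTheorem2 (f : ℤ[X]) (n : ℕ) (hdeg : f.natDegree = n) (hn : 1 < n)
    (hsep : (f.map (Int.castRingHom ℚ)).Separable)
    (p : ℕ) [Fact p.Prime]
    (hlc : ¬ (p : ℤ) ∣ f.leadingCoeff)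
    (hsep_p : (f.map (Int.castRingHom (ZMod p))).Separable)
    (r : ℕ) (F : Fin r → ℤ_[p][X]) (hF : AllCoefficients.IsLocalFactorization p f F)
    (l : ℕ) (hl : 0 < l)
    (A : Matrix (Fin n) (Fin r) ℤ) (hA : AllCoefficients.IsCoeffMatrix p l f F A)
    (b : Fin (r + n) → Fin r ⊕ Fin n → ℤ)
    (hb_span : Submodule.span ℤ (Set.range b) = AllCoefficients.allCoeffLattice p l A)
    (hb_red : AllCoefficients.IsLLLReduced b)
    (t : ℕ) (ht : AllCoefficients.IsCutoff b (AllCoefficients.boundB' f r) t)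
    (hbound : AllCoefficients.polyNorm f * (2 ^ (n - 1) + (n : ℝ)) *
        AllCoefficients.boundB' f r * (1 + AllCoefficients.boundB' f r)
      < (p : ℝ) ^ ((l : ℝ) / (n : ℝ))) :
    Submodule.map (LinearMap.funLeft ℤ ℤ (Sum.inl : Fin r → Fin r ⊕ Fin n))
        (AllCoefficients.headLattice b t)
      = AllCoefficients.factorLattice p f F := by
  have hf : f ≠ 0 := by
    rintro rfl
    rw [natDegree_zero] at hdeg
    omega
  have hr : r ≤ n := hdeg ▸ hF.card_le_natDegree hf
  refine le_antisymm ?_ ?_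
  · rw [AllCoefficients.headLattice, Submodule.map_span, Submodule.span_le]
    rintro _ ⟨_, ⟨k, hk, rfl⟩, rfl⟩
    have hkL : b k ∈ AllCoefficients.allCoeffLattice p l A :=
      hb_span ▸ Submodule.subset_span (Set.mem_range_self k)
    have hkB : ‖AllCoefficients.toEuclid (b k)‖ ^ 2 ≤
        2 ^ (2 * n - 1) * AllCoefficients.boundB' f r ^ 2 := by
      refine (hb_red.norm_toEuclid_sq_le_of_lt_cutoff ht hk).trans ?_
      -- The exponent comes from t ≤ r + n ≤ 2n.
      have := ht.le
      gcongr
      · norm_num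
      · omega
    exact AllCoefficients.mem_factorLattice_of_const hF hf hsep fun e he i j hi hj =>
      hA.apply_eq_apply_of_short hF hdeg hn hsep hbound hkL hkB he hi hj
  · rw [AllCoefficients.factorLattice, Submodule.span_le]
    rintro _ ⟨e, he, rfl⟩
    obtain ⟨v, hvL, hvB, hve⟩ := hA.exists_short_vector hF hdeg hf hsep he
    refine ⟨v, ht.mem_headLattice (AllCoefficients.boundB'_nonneg f r) (hb_span ▸ hvL) hvB, ?_⟩
    funext j
    exact hve j
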